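/- All groups are finite. Let $\sigma$ be a partition of the set of all primes and write $\sigma(G)$ for the set of those $\sigma_i\in\sigma$ that contain a prime dividing $|G|$, and $\sigma(\mathfrak F)=\bigcup_{G\in\mathfrak F}\sigma(G)$. A formation is a (possibly empty) class of groups, closed under isomorphism, that contains $G/N$ whenever it contains $G$, and contains $G/(N\cap R)$ whenever it contains $G/N$ and $G/R$. For a function $f$ from $\sigma$ to formations, $LF_\sigma(f)$ is the class of all $G$ such that $G=1$, or $G\neq1$ and $G/O_{\sigma_i',\sigma_i}(G)\in f(\sigma_i)$ for all $\sigma_i\in\sigma(G)$. Every formation is $0$-multiply $\sigma$-local; for $n>0$ a formation $\mathfrak F$ is $n$-multiply $\sigma$-local if $\mathfrak F=(1)$ (the class of identity groups), or $\mathfrak F=LF_\sigma(f)$ for some $f$ such that $f(\sigma_i)$ is $(n-1)$-multiply $\sigma$-local for all $\sigma_i\in\sigma(\mathfrak F)$. A subgroup functor $\tau$ assigns to every group $G$ a set $\tau(G)$ of subgroups with $G\in\tau(G)$ such that for every epimorphism $\varphi:A\to B$, $H\in\tau(A)$ and $T\in\tau(B)$ one has $H^{\varphi}\in\tau(B)$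 and $T^{\varphi^{-1}}\in\tau(A)$; a class $\mathfrak F$ is $\tau$-closed if $\tau(G)\subseteq\mathfrak F$ for all $G\in\mathfrak F$. Let $\tau$ be a subgroup functor, $n\ge0$ an integer, and let $l^\tau_{\sigma_n}$ be the collection of all $\tau$-closed $n$-multiply $\sigma$-local formations. For a collection of groups $\mathfrak X$ let $l^\tau_{\sigma_n}\mathrm{form}\,\mathfrak X$ be the intersection of all members of $l^\tau_{\sigma_n}$ containing $\mathfrak X$, and put $\mathfrak M\vee^\tau_{\sigma_n}\mathfrak H=l^\tau_{\sigma_n}\mathrm{form}(\mathfrak M\cup\mathfrak H)$. **Theorem.** The collection $l^\tau_{\sigma_n}$ is a complete lattice of formations (a nonempty collection of formations, closed under intersections of nonempty families, with a largest member), and it is $\mathfrak G$-separable, where $\mathfrak G$ is the class of all groups: for every term $\nu(x_1,\dots,x_m)$ of signature $\{\cap,\vee^\tau_{\sigma_n}\}$, all $\mathfrak F_1,\dots,\mathfrak F_m\in l^\tau_{\sigma_n}$ and every group $A\in\nu(\mathfrak F_1,\dots,\mathfrak F_m)$, there are groups $A_1,\dots,A_m$, with $A_j\in\mathfrak F_j$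 for every $j$ such that $\mathfrak F_j\neq\varnothing$, such that $$A\in\nu(l^\tau_{\sigma_n}\mathrm{form}\,A_1,\dots,l^\tau_{\sigma_n}\mathrm{form}\,A_m).$$ (For $n\ge1$ every member of $l^\tau_{\sigma_n}$ is nonempty, so $A_j\in\mathfrak F_j$ for all $j$.) -/

import Mathlib

universe u

namespace SigmaFormations

/-- A collection of finite groups. -/
abbrev GroupClass : Type (u + 1) := Set FiniteGrp.{u}

/-- `𝔊`: all finite groups. -/
def allGroups : GroupClass.{u} := Set.univ

/-- `(1)`: the identity groups. -/
def identityGroups : GroupClass.{u} := {G | Subsingleton G}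

/-- A formation: a class of groups (closed under isomorphic copies) which is closed under quotients
and contains `G / (N ∩ R)` as soon as it contains `G / N` and `G / R`. The empty class is allowed. -/
structure IsFormation (𝔉 : GroupClass.{u}) : Prop where
  iso : ∀ A B : FiniteGrp.{u}, Nonempty (A ≃* B) → A ∈ 𝔉 → B ∈ 𝔉
  quotient : ∀ (G : FiniteGrp.{u}) (N : Subgroup G) [N.Normal],
    G ∈ 𝔉 → FiniteGrp.of (G ⧸ N) ∈ 𝔉
  subdirect : ∀ (G : FiniteGrp.{u}) (N R : Subgroup G) [N.Normal] [R.Normal],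
    FiniteGrp.of (G ⧸ N) ∈ 𝔉 → FiniteGrp.of (G ⧸ R) ∈ 𝔉 → FiniteGrp.of (G ⧸ (N ⊓ R)) ∈ 𝔉

/-- `π(G)`: the primes dividing the order of `G`. -/
def primesOf (G : Type u) : Set Nat.Primes := {p | (p : ℕ) ∣ Nat.card G}

/-- `O_π(G)`: the largest normal `π`-subgroup of `G` (the join of all normal `π`-subgroups). -/
def piCore (π : Set Nat.Primes) (G : Type u) [Group G] : Subgroup G :=
  ⨆ N : {N : Subgroup G // N.Normal ∧ primesOf N ⊆ π}, (N : Subgroup G)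

instance piCore_normal (π : Set Nat.Primes) (G : Type u) [Group G] : (piCore π G).Normal := by
  have : ∀ N : {N : Subgroup G // N.Normal ∧ primesOf N ⊆ π}, (N : Subgroup G).Normal :=
    fun N => N.2.1
  unfold piCore
  infer_instance

/-- `O_{π, ν}(G)`, determined by `O_{π, ν}(G) / O_π(G) = O_ν(G / O_π(G))`. -/
def piCore₂ (π ν : Set Nat.Primes) (G : Type u) [Group G] : Subgroup G :=
  (piCore ν (G ⧸ piCore π G)).comap (QuotientGroup.mk' (piCore π G))

instance piCore₂_normal (π ν : Set Nat.Primes) (G : Type u) [Group G] :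
    (piCore₂ π ν G).Normal := by
  unfold piCore₂
  infer_instance

section Sigma

variable (σ : Set (Set Nat.Primes))

/-- `σ(G)`: the members of `σ` that meet `π(G)`. -/
def sigmaOf (G : FiniteGrp.{u}) : Set σ := {s | ((s : Set Nat.Primes) ∩ primesOf G).Nonempty}

/-- `σ(𝔉)`: the union of the sets `σ(G)`, `G ∈ 𝔉`. -/
def sigmaOfClass (𝔉 : GroupClass.{u}) : Set σ := ⋃ G ∈ 𝔉, sigmaOf σ G

/-- `LF_σ(f)`: all `G` with `G = 1`, or `G ≠ 1` and `G / O_{s', s}(G) ∈ f(s)` for all `s ∈ σ(G)`. -/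
def LF (f : σ → GroupClass.{u}) : GroupClass.{u} :=
  {G | Subsingleton G ∨ (Nontrivial G ∧ ∀ s ∈ sigmaOf σ G,
    FiniteGrp.of (G ⧸ piCore₂ (s : Set Nat.Primes)ᶜ (s : Set Nat.Primes) G) ∈ f s)}

/-- `n`-multiply `σ`-local formations. -/
def IsMultiplyLocal : ℕ → GroupClass.{u} → Prop
  | 0, 𝔉 => IsFormation 𝔉
  | n + 1, 𝔉 => IsFormation 𝔉 ∧ (𝔉 = identityGroups ∨
      ∃ f : σ → GroupClass.{u}, (∀ s, IsFormation (f s)) ∧ 𝔉 = LF σ f ∧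
        ∀ s ∈ sigmaOfClass σ 𝔉, IsMultiplyLocal n (f s))

end Sigma

/-- A subgroup functor: a choice of a set `τ(G)` of subgroups of each finite group `G`, containing
`G` itself, stable under images and preimages along epimorphisms. -/
structure SubgroupFunctor where
  sub : ∀ G : FiniteGrp.{u}, Set (Subgroup G)
  top_mem : ∀ G, ⊤ ∈ sub G
  map_mem : ∀ (A B : FiniteGrp.{u}) (φ : A →* B), Function.Surjective φ →
    ∀ H ∈ sub A, H.map φ ∈ sub B
  comap_mem : ∀ (A B : FiniteGrp.{u}) (φ : A →* B), Function.Surjective φ →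
    ∀ T ∈ sub B, T.comap φ ∈ sub A

/-- `τ`-closed classes: `τ(G) ⊆ 𝔉` for all `G ∈ 𝔉`. -/
def SubgroupFunctor.IsClosed (τ : SubgroupFunctor.{u}) (𝔉 : GroupClass.{u}) : Prop :=
  ∀ G ∈ 𝔉, ∀ H ∈ τ.sub G, FiniteGrp.of H ∈ 𝔉

/-- `l^τ_{σ_n}`: the collection of all `τ`-closed `n`-multiply `σ`-local formations. -/
def closedMultiplyLocal (τ : SubgroupFunctor.{u}) (σ : Set (Set Nat.Primes)) (n : ℕ) :
    Set GroupClass.{u} :=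
  {𝔉 | IsMultiplyLocal σ n 𝔉 ∧ τ.IsClosed 𝔉}

/-- `θ form 𝔛`: the intersection of all members of `θ` containing `𝔛`. -/
def form (θ : Set GroupClass.{u}) (𝔛 : GroupClass.{u}) : GroupClass.{u} :=
  ⋂₀ {𝔉 | 𝔉 ∈ θ ∧ 𝔛 ⊆ 𝔉}

/-- A complete lattice of formations: a nonempty collection of formations, closed under
intersections, that has a largest member. -/
structure IsCompleteLattice (θ : Set GroupClass.{u}) : Prop where
  nonempty : θ.Nonempty
  isFormation : ∀ 𝔉 ∈ θ, IsFormation 𝔉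
  sInter_mem : ∀ S ⊆ θ, S.Nonempty → ⋂₀ S ∈ θ
  exists_greatest : ∃ 𝔉 ∈ θ, ∀ ℌ ∈ θ, ℌ ⊆ 𝔉

/-- Lattice terms in the variables `x_1, …, x_m`. -/
inductive LatticeTerm (m : ℕ) : Type
  | var : Fin m → LatticeTerm m
  | inter : LatticeTerm m → LatticeTerm m → LatticeTerm m
  | join : LatticeTerm m → LatticeTerm m → LatticeTerm m

/-- The value `ν(𝔉_1, …, 𝔉_m)` of a term of signature `{∩, ∨_θ}`, where
`𝔐 ∨_θ ℌ = θ form (𝔐 ∪ ℌ)`. -/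
def LatticeTerm.eval (θ : Set GroupClass.{u}) {m : ℕ} (𝔉 : Fin m → GroupClass.{u}) :
    LatticeTerm m → GroupClass.{u}
  | .var j => 𝔉 j
  | .inter a b => a.eval θ 𝔉 ∩ b.eval θ 𝔉
  | .join a b => form θ (a.eval θ 𝔉 ∪ b.eval θ 𝔉)

/-- `𝔛`-separability of a complete lattice of formations `θ`: for every term `ν`, all `θ`-formations
`𝔉_1, …, 𝔉_m` and every `A ∈ 𝔛 ∩ ν(𝔉_1, …, 𝔉_m)` there are `𝔛`-groups `A_j ∈ 𝔉_j` with
`A ∈ ν(θ form A_1, …, θ form A_m)`. An empty `𝔉_j` contains no group, so in that case (and only then)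
`A_j` is just some `𝔛`-group. -/
structure IsSeparable (𝔛 : GroupClass.{u}) (θ : Set GroupClass.{u}) : Prop where
  isCompleteLattice : IsCompleteLattice θ
  separable : ∀ (m : ℕ) (ν : LatticeTerm m) (𝔉 : Fin m → GroupClass.{u}), (∀ j, 𝔉 j ∈ θ) →
    ∀ A ∈ 𝔛 ∩ ν.eval θ 𝔉, ∃ B : Fin m → FiniteGrp.{u},
      (∀ j, B j ∈ 𝔛) ∧ (∀ j, (𝔉 j).Nonempty → B j ∈ 𝔉 j) ∧
        A ∈ ν.eval θ (fun j => form θ {B j})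

end SigmaFormations

/-!
Write `θ` for the collection of `τ`-closed `n`-multiply `σ`-local formations. Separability is a
finiteness property of the closure operator `θ form`. Suppose that every group of `θ form 𝔛` lies in
`θ form 𝔜` for a finite `𝔜 ⊆ 𝔛` (`exists_finite_mem_form`). An induction on the term `ν` then
reduces every membership `A ∈ ν(𝔉₁, …, 𝔉ₘ)` to finitely many groups of each `𝔉ⱼ`. A formation is
closed under direct products, and each factor is a quotient of the product, so these finitely many
groups can be replaced by their direct product (`isSeparable_of_directed`).

The closure operator is finitary as soon as `θ` is closed under directed unions, because then
`θ form 𝔛` is the union of the directed family of all `θ form 𝔜` with `𝔜 ⊆ 𝔛` finite. That `θ` is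
closed under directed unions is proved by induction on `n`. Every `(n + 1)`-multiply `σ`-local
formation `𝔉` equals `LF_σ(f)` for its smallest satellite `f` (`LF_minimalSatellite`), and this `f`
is monotone in `𝔉`. Hence for a directed family the values `f(σᵢ)` are again directed, and their
unions define the union of the family: a group `G` involves only finitely many of the conditions
`G / O_{σᵢ', σᵢ}(G) ∈ f(σᵢ)`, since `σ(G)` is finite, so all of them already hold for one member of
the family (`isMultiplyLocal_sUnion`).
-/

namespace SigmaFormations

/-! ### Formations -/

theorem isFormation_empty : IsFormation (∅ : GroupClass.{u}) where
  iso _ _ _ h := h.elim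
  quotient _ _ _ h := h.elim
  subdirect _ _ _ _ _ h := h.elim

theorem isFormation_allGroups : IsFormation allGroups.{u} where
  iso _ _ _ _ := trivial
  quotient _ _ _ _ := trivial
  subdirect _ _ _ _ _ _ _ := trivial

theorem isFormation_sInter {S : Set GroupClass.{u}} (hS : ∀ 𝔉 ∈ S, IsFormation 𝔉) :
    IsFormation (⋂₀ S) where
  iso A B e h 𝔉 h𝔉 := (hS 𝔉 h𝔉).iso A B e (h 𝔉 h𝔉)
  quotient G N _ h 𝔉 h𝔉 := (hS 𝔉 h𝔉).quotient G N (h 𝔉 h𝔉)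
  subdirect G N R _ _ h₁ h₂ 𝔉 h𝔉 := (hS 𝔉 h𝔉).subdirect G N R (h₁ 𝔉 h𝔉) (h₂ 𝔉 h𝔉)

theorem isFormation_sUnion {S : Set GroupClass.{u}} (hd : DirectedOn (· ⊆ ·) S)
    (hS : ∀ 𝔉 ∈ S, IsFormation 𝔉) : IsFormation (⋃₀ S) where
  iso A B e := fun ⟨𝔉, h𝔉, h⟩ => ⟨𝔉, h𝔉, (hS 𝔉 h𝔉).iso A B e h⟩
  quotient G N _ := fun ⟨𝔉, h𝔉, h⟩ => ⟨𝔉, h𝔉, (hS 𝔉 h𝔉).quotient G N h⟩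
  subdirect G N R _ _ := fun ⟨𝔉₁, h𝔉₁, h₁⟩ ⟨𝔉₂, h𝔉₂, h₂⟩ => by
    obtain ⟨𝔉, h𝔉, le₁, le₂⟩ := hd 𝔉₁ h𝔉₁ 𝔉₂ h𝔉₂
    exact ⟨𝔉, h𝔉, (hS 𝔉 h𝔉).subdirect G N R (le₁ h₁) (le₂ h₂)⟩

theorem IsFormation.of_surjective {𝔉 : GroupClass.{u}} (h𝔉 : IsFormation 𝔉) {A B : FiniteGrp.{u}}
    (φ : A →* B) (hφ : Function.Surjective φ) (hA : A ∈ 𝔉) : B ∈ 𝔉 :=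
  h𝔉.iso (FiniteGrp.of (A ⧸ φ.ker)) B ⟨QuotientGroup.quotientKerEquivOfSurjective φ hφ⟩
    (h𝔉.quotient A φ.ker hA)

/-- The direct product of two finite groups. -/
abbrev prod (A B : FiniteGrp.{u}) : FiniteGrp.{u} := FiniteGrp.of (A × B)

theorem IsFormation.prod_mem {𝔉 : GroupClass.{u}} (h𝔉 : IsFormation 𝔉) {A B : FiniteGrp.{u}}
    (hA : A ∈ 𝔉) (hB : B ∈ 𝔉) : prod A B ∈ 𝔉 := by
  let p : prod A B →* A := MonoidHom.fst A B
  let q : prod A B →* B := MonoidHom.snd A B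
  have hp : Function.Surjective p := Prod.fst_surjective
  have hq : Function.Surjective q := Prod.snd_surjective
  have h := h𝔉.subdirect (prod A B) p.ker q.ker
    (h𝔉.iso A _ ⟨(QuotientGroup.quotientKerEquivOfSurjective p hp).symm⟩ hA)
    (h𝔉.iso B _ ⟨(QuotientGroup.quotientKerEquivOfSurjective q hq).symm⟩ hB)
  have hbot : p.ker ⊓ q.ker = ⊥ := by
    rw [eq_bot_iff]
    rintro x ⟨h₁, h₂⟩
    exact Prod.ext h₁ h₂
  exact h𝔉.iso _ _
    ⟨(QuotientGroup.quotientMulEquivOfEq hbot).trans QuotientGroup.quotientBot⟩ h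

/-! ### Generated formations and separability -/

theorem subset_form (θ : Set GroupClass.{u}) (𝔛 : GroupClass.{u}) : 𝔛 ⊆ form θ 𝔛 :=
  Set.subset_sInter fun _ h => h.2

theorem form_subset {θ : Set GroupClass.{u}} {𝔛 𝔉 : GroupClass.{u}} (h𝔉 : 𝔉 ∈ θ) (h : 𝔛 ⊆ 𝔉) :
    form θ 𝔛 ⊆ 𝔉 :=
  Set.sInter_subset_of_mem ⟨h𝔉, h⟩

theorem form_mono (θ : Set GroupClass.{u}) {𝔛 𝔜 : GroupClass.{u}} (h : 𝔛 ⊆ 𝔜) :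
    form θ 𝔛 ⊆ form θ 𝔜 :=
  Set.sInter_subset_sInter fun _ h' => ⟨h'.1, h.trans h'.2⟩

theorem IsCompleteLattice.form_mem {θ : Set GroupClass.{u}} (hθ : IsCompleteLattice θ)
    (htop : allGroups ∈ θ) (𝔛 : GroupClass.{u}) : form θ 𝔛 ∈ θ :=
  hθ.sInter_mem _ (fun _ h => h.1) ⟨allGroups, htop, Set.subset_univ 𝔛⟩

theorem LatticeTerm.eval_mono (θ : Set GroupClass.{u}) {m : ℕ} (ν : LatticeTerm m)
    {𝔉 ℌ : Fin m → GroupClass.{u}} (h : ∀ j, 𝔉 j ⊆ ℌ j) : ν.eval θ 𝔉 ⊆ ν.eval θ ℌ := by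
  induction ν with
  | var j => exact h j
  | inter a b iha ihb => exact Set.inter_subset_inter iha ihb
  | join a b iha ihb => exact form_mono θ (Set.union_subset_union iha ihb)

/-- In a complete lattice of formations that is closed under directed unions, generation is
finitary. -/
theorem exists_finite_mem_form {θ : Set GroupClass.{u}} (hθ : IsCompleteLattice θ)
    (htop : allGroups ∈ θ)
    (hdir : ∀ S ⊆ θ, S.Nonempty → DirectedOn (· ⊆ ·) S → ⋃₀ S ∈ θ)
    {𝔛 : GroupClass.{u}} {A : FiniteGrp.{u}} (hA : A ∈ form θ 𝔛) :
    ∃ 𝔜 ⊆ 𝔛, 𝔜.Finite ∧ A ∈ form θ 𝔜 := by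
  let S : Set GroupClass.{u} := {ℌ | ∃ 𝔜 ⊆ 𝔛, 𝔜.Finite ∧ form θ 𝔜 = ℌ}
  have hmem : ⋃₀ S ∈ θ := by
    refine hdir S ?_ ⟨_, ∅, Set.empty_subset _, Set.finite_empty, rfl⟩ ?_
    · rintro _ ⟨𝔜, -, -, rfl⟩
      exact hθ.form_mem htop 𝔜
    · rintro _ ⟨𝔜₁, h₁, f₁, rfl⟩ _ ⟨𝔜₂, h₂, f₂, rfl⟩
      exact ⟨_, ⟨𝔜₁ ∪ 𝔜₂, Set.union_subset h₁ h₂, f₁.union f₂, rfl⟩,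
        form_mono θ Set.subset_union_left, form_mono θ Set.subset_union_right⟩
  have hsub : 𝔛 ⊆ ⋃₀ S := fun G hG =>
    ⟨_, ⟨{G}, Set.singleton_subset_iff.2 hG, Set.finite_singleton G, rfl⟩,
      subset_form θ {G} rfl⟩
  obtain ⟨_, ⟨𝔜, h𝔜, hfin, rfl⟩, hA'⟩ := form_subset hmem hsub hA
  exact ⟨𝔜, h𝔜, hfin, hA'⟩

/-- Closure under directed unions implies separability. The tuples `B` with `B j ∈ 𝔉 j` whenever
`𝔉 j` is nonempty form a directed family under inclusion of the generated formations, and each value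
`μ(𝔉₁, …, 𝔉ₘ)` is covered by the values of `μ` at the formations generated by the components of such
tuples. -/
theorem isSeparable_of_directed {θ : Set GroupClass.{u}} (hθ : IsCompleteLattice θ)
    (htop : allGroups ∈ θ)
    (hdir : ∀ S ⊆ θ, S.Nonempty → DirectedOn (· ⊆ ·) S → ⋃₀ S ∈ θ) :
    IsSeparable allGroups θ := by
  classical
  refine ⟨hθ, fun m ν 𝔉 h𝔉 A hA => ?_⟩
  have hform : ∀ 𝔛 : GroupClass.{u}, IsFormation (form θ 𝔛) := fun 𝔛 =>
    hθ.isFormation _ (hθ.form_mem htop 𝔛)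
  let I := {B : Fin m → FiniteGrp.{u} // ∀ j, (𝔉 j).Nonempty → B j ∈ 𝔉 j}
  let gen : I → Fin m → GroupClass.{u} := fun B j => form θ {B.1 j}
  -- Componentwise products bound two tuples, whether or not some `𝔉 j` is empty.
  have hgen : Directed (fun 𝔐 ℌ : Fin m → GroupClass.{u} => ∀ j, 𝔐 j ⊆ ℌ j) gen := by
    rintro ⟨B, hB⟩ ⟨C, hC⟩
    refine ⟨⟨fun j => prod (B j) (C j), fun j hj =>
      (hθ.isFormation _ (h𝔉 j)).prod_mem (hB j hj) (hC j hj)⟩, fun j => ?_, fun j => ?_⟩ <;>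
    refine form_subset (hθ.form_mem htop _) (Set.singleton_subset_iff.2 ?_)
    · exact (hform _).of_surjective (A := prod (B j) (C j)) (MonoidHom.fst (B j) (C j))
        Prod.fst_surjective (subset_form θ _ rfl)
    · exact (hform _).of_surjective (A := prod (B j) (C j)) (MonoidHom.snd (B j) (C j))
        Prod.snd_surjective (subset_form θ _ rfl)
  have hne : Nonempty I :=
    ⟨fun j => if h : (𝔉 j).Nonempty then h.some else FiniteGrp.of PUnit, fun j h => by
      simpa only [dif_pos h] using h.some_mem⟩
  have key : ∀ (μ : LatticeTerm m), μ.eval θ 𝔉 ⊆ ⋃ B : I, μ.eval θ (gen B) := by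
    intro μ
    induction μ with
    | var j =>
      intro A hA
      obtain ⟨B, hB⟩ := hne
      refine Set.mem_iUnion.2 ⟨⟨Function.update B j A, fun i hi => ?_⟩, ?_⟩
      · by_cases hij : i = j
        · subst hij
          rw [Function.update_self]
          exact hA
        · rw [Function.update_of_ne hij]
          exact hB i hi
      · exact subset_form θ _ (Set.mem_singleton_iff.2 (Function.update_self j A B).symm)
    | inter a b iha ihb =>
      rintro A ⟨ha, hb⟩
      obtain ⟨B, hB⟩ := Set.mem_iUnion.1 (iha ha)
      obtain ⟨C, hC⟩ := Set.mem_iUnion.1 (ihb hb)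
      obtain ⟨D, hBD, hCD⟩ := hgen B C
      exact Set.mem_iUnion.2 ⟨D, a.eval_mono θ hBD hB, b.eval_mono θ hCD hC⟩
    | join a b iha ihb =>
      intro A hA
      obtain ⟨𝔜, h𝔜, hfin, hA⟩ := exists_finite_mem_form hθ htop hdir hA
      have hd : Directed (· ⊆ ·) fun B : I => a.eval θ (gen B) ∪ b.eval θ (gen B) :=
        fun B C => (hgen B C).imp fun _ h =>
          ⟨Set.union_subset_union (a.eval_mono θ h.1) (b.eval_mono θ h.1),
            Set.union_subset_union (a.eval_mono θ h.2) (b.eval_mono θ h.2)⟩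
      obtain ⟨B, hB⟩ := hd.exists_mem_subset_of_finset_subset_biUnion (s := hfin.toFinset) <| by
        rw [hfin.coe_toFinset, Set.iUnion_union_distrib]
        exact h𝔜.trans (Set.union_subset_union iha ihb)
      rw [hfin.coe_toFinset] at hB
      exact Set.mem_iUnion.2 ⟨B, form_mono θ hB hA⟩
  obtain ⟨B, hB⟩ := Set.mem_iUnion.1 (key ν hA.2)
  exact ⟨B.1, fun _ => trivial, B.2, hB⟩

/-! ### Local definitions of formations -/

section Sigma

variable {σ : Set (Set Nat.Primes)}

theorem sigmaOf_eq_empty (G : FiniteGrp.{u}) [Subsingleton G] : sigmaOf σ G = ∅ := by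
  rw [Set.eq_empty_iff_forall_notMem]
  rintro s ⟨p, -, hp⟩
  have hp' : (p : ℕ) ∣ Nat.card G := hp
  rw [Nat.card_of_subsingleton (1 : G)] at hp'
  exact p.2.one_lt.ne' (Nat.dvd_one.1 hp')

theorem sigmaOf_nonempty (hσ : Setoid.IsPartition σ) (G : FiniteGrp.{u}) [Nontrivial G] :
    (sigmaOf σ G).Nonempty := by
  obtain ⟨p, hp, hdvd⟩ := Nat.exists_prime_and_dvd (Finite.one_lt_card (α := G)).ne'
  obtain ⟨s, ⟨hs, hps⟩, -⟩ := hσ.2 ⟨p, hp⟩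
  exact ⟨⟨s, hs⟩, ⟨p, hp⟩, hps, hdvd⟩

theorem finite_sigmaOf (hσ : Setoid.IsPartition σ) (G : FiniteGrp.{u}) :
    (sigmaOf σ G).Finite := by
  have hprimes : (primesOf G).Finite := by
    refine Set.Finite.of_finite_image (f := Subtype.val) ?_ Subtype.val_injective.injOn
    refine (Nat.card G).divisors.finite_toSet.subset ?_
    rintro _ ⟨p, hp, rfl⟩
    exact Nat.mem_divisors.2 ⟨hp, Nat.card_pos.ne'⟩
  choose c hc huniq using hσ.2
  refine (hprimes.image fun p => (⟨c p, (hc p).1⟩ : σ)).subset ?_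
  rintro s ⟨p, hps, hp⟩
  exact ⟨p, hp, Subtype.ext (huniq p s ⟨s.2, hps⟩).symm⟩

theorem mem_sigmaOfClass {𝔉 : GroupClass.{u}} {s : σ} :
    s ∈ sigmaOfClass σ 𝔉 ↔ ∃ G ∈ 𝔉, s ∈ sigmaOf σ G := by
  simp [sigmaOfClass]

theorem sigmaOfClass_mono {𝔉 ℌ : GroupClass.{u}} (h : 𝔉 ⊆ ℌ) :
    sigmaOfClass σ 𝔉 ⊆ sigmaOfClass σ ℌ :=
  Set.biUnion_subset_biUnion_left h

/-- The quotient `G / O_{s', s}(G)`. -/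
abbrev localQuotient (s : σ) (G : FiniteGrp.{u}) : FiniteGrp.{u} :=
  FiniteGrp.of (G ⧸ piCore₂ (s : Set Nat.Primes)ᶜ (s : Set Nat.Primes) G)

theorem mem_LF {f : σ → GroupClass.{u}} {G : FiniteGrp.{u}} :
    G ∈ LF σ f ↔ ∀ s ∈ sigmaOf σ G, localQuotient s G ∈ f s := by
  refine ⟨?_, fun h => ?_⟩
  · rintro (hG | hG) s hs
    · rw [sigmaOf_eq_empty] at hs
      exact hs.elim
    · exact hG.2 s hs
  · exact (subsingleton_or_nontrivial G).imp id fun hG => ⟨hG, h⟩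

theorem LF_empty (hσ : Setoid.IsPartition σ) :
    LF σ (fun _ => (∅ : GroupClass.{u})) = identityGroups := by
  ext G
  refine ⟨?_, Or.inl⟩
  rintro (hG | ⟨_, hG⟩)
  · exact hG
  · obtain ⟨s, hs⟩ := sigmaOf_nonempty hσ G
    exact (hG s hs).elim

theorem sigmaOfClass_identityGroups : sigmaOfClass σ identityGroups.{u} = ∅ := by
  rw [Set.eq_empty_iff_forall_notMem]
  intro s hs
  obtain ⟨G, hG, hs⟩ := mem_sigmaOfClass.1 hs
  have : Subsingleton G := hG
  rw [sigmaOf_eq_empty] at hs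
  exact hs

/-- The class `(1)` needs no separate treatment, since it is defined by the empty satellite. -/
theorem isMultiplyLocal_succ_iff (hσ : Setoid.IsPartition σ) {n : ℕ} {𝔉 : GroupClass.{u}} :
    IsMultiplyLocal σ (n + 1) 𝔉 ↔ IsFormation 𝔉 ∧ ∃ f : σ → GroupClass.{u},
      (∀ s, IsFormation (f s)) ∧ 𝔉 = LF σ f ∧
        ∀ s ∈ sigmaOfClass σ 𝔉, IsMultiplyLocal σ n (f s) := by
  refine ⟨fun ⟨h, h'⟩ => ⟨h, ?_⟩, fun ⟨h, h'⟩ => ⟨h, Or.inr h'⟩⟩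
  rcases h' with rfl | h'
  · refine ⟨fun _ => ∅, fun _ => isFormation_empty, (LF_empty hσ).symm, fun s hs => ?_⟩
    rw [sigmaOfClass_identityGroups] at hs
    exact hs.elim
  · exact h'

theorem IsMultiplyLocal.isFormation {n : ℕ} {𝔉 : GroupClass.{u}} (h : IsMultiplyLocal σ n 𝔉) :
    IsFormation 𝔉 := by
  cases n with
  | zero => exact h
  | succ n => exact h.1

theorem isMultiplyLocal_allGroups (n : ℕ) : IsMultiplyLocal σ n allGroups.{u} := by
  induction n with
  | zero => exact isFormation_allGroups
  | succ n ih =>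
    exact ⟨isFormation_allGroups, Or.inr ⟨fun _ => allGroups, fun _ => isFormation_allGroups,
      (Set.eq_univ_of_forall fun G =>
        mem_LF.2 fun _ _ => Set.mem_univ _).symm, fun _ _ => ih⟩⟩

theorem isMultiplyLocal_sInter (hσ : Setoid.IsPartition σ) (n : ℕ) {S : Set GroupClass.{u}}
    (hS : ∀ 𝔉 ∈ S, IsMultiplyLocal σ n 𝔉) : IsMultiplyLocal σ n (⋂₀ S) := by
  induction n generalizing S with
  | zero => exact isFormation_sInter hS
  | succ n ih =>
    have h := fun 𝔉 : S => ((isMultiplyLocal_succ_iff hσ).1 (hS 𝔉 𝔉.2)).2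
    choose f hf hLF hloc using h
    refine (isMultiplyLocal_succ_iff hσ).2
      ⟨isFormation_sInter fun 𝔉 h => (hS 𝔉 h).isFormation,
        fun s => ⋂₀ Set.range fun 𝔉 => f 𝔉 s, fun s => ?_, ?_, fun s hs => ih ?_⟩
    · refine isFormation_sInter ?_
      rintro _ ⟨𝔉, rfl⟩
      exact hf 𝔉 s
    · ext G
      rw [mem_LF]
      constructor
      · rintro hG s hs _ ⟨𝔉, rfl⟩
        have hG' := hG 𝔉 𝔉.2
        rw [hLF 𝔉] at hG'
        exact mem_LF.1 hG' s hs
      · intro hG 𝔉 h𝔉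
        exact (hLF ⟨𝔉, h𝔉⟩).symm.subset (mem_LF.2 fun s hs => hG s hs _ ⟨⟨𝔉, h𝔉⟩, rfl⟩)
    · rintro _ ⟨𝔉, rfl⟩
      exact hloc 𝔉 s (sigmaOfClass_mono (Set.sInter_subset_of_mem 𝔉.2) hs)

/-! ### Minimal satellites and directed unions -/

/-- The smallest satellite of an `(n + 1)`-multiply `σ`-local formation `𝔉`: on `σ(𝔉)`, its value at
`s` is the `n`-multiply `σ`-local formation generated by the quotients `G / O_{s', s}(G)` of the
groups `G ∈ 𝔉` with `s ∈ σ(G)`. Outside `σ(𝔉)` the value is empty. -/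
def minimalSatellite (σ : Set (Set Nat.Primes)) (n : ℕ) (𝔉 : GroupClass.{u}) (s : σ) :
    GroupClass.{u} :=
  {H | s ∈ sigmaOfClass σ 𝔉 ∧
    H ∈ form {ℌ | IsMultiplyLocal σ n ℌ} {K | ∃ G ∈ 𝔉, s ∈ sigmaOf σ G ∧ K = localQuotient s G}}

theorem minimalSatellite_mono (n : ℕ) {𝔉 ℌ : GroupClass.{u}} (h : 𝔉 ⊆ ℌ) (s : σ) :
    minimalSatellite σ n 𝔉 s ⊆ minimalSatellite σ n ℌ s := fun _ hH =>
  ⟨sigmaOfClass_mono h hH.1,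
    form_mono _ (Set.ofPred_subset_ofPred.2 fun _ ⟨G, hG, hs, hK⟩ => ⟨G, h hG, hs, hK⟩) hH.2⟩

theorem isMultiplyLocal_minimalSatellite (hσ : Setoid.IsPartition σ) (n : ℕ) {𝔉 : GroupClass.{u}}
    {s : σ} (hs : s ∈ sigmaOfClass σ 𝔉) : IsMultiplyLocal σ n (minimalSatellite σ n 𝔉 s) := by
  simp only [minimalSatellite, hs, true_and, Set.ofPred_mem_eq]
  exact isMultiplyLocal_sInter hσ n fun _ h => h.1

theorem isFormation_minimalSatellite (hσ : Setoid.IsPartition σ) (n : ℕ) (𝔉 : GroupClass.{u})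
    (s : σ) : IsFormation (minimalSatellite σ n 𝔉 s) := by
  by_cases hs : s ∈ sigmaOfClass σ 𝔉
  · exact (isMultiplyLocal_minimalSatellite hσ n hs).isFormation
  · have : minimalSatellite σ n 𝔉 s = ∅ := Set.eq_empty_of_forall_notMem fun _ h => hs h.1
    rw [this]
    exact isFormation_empty

theorem LF_minimalSatellite (hσ : Setoid.IsPartition σ) {n : ℕ} {𝔉 : GroupClass.{u}}
    (h𝔉 : IsMultiplyLocal σ (n + 1) 𝔉) : LF σ (minimalSatellite σ n 𝔉) = 𝔉 := by
  obtain ⟨-, f, -, hLF, hloc⟩ := (isMultiplyLocal_succ_iff hσ).1 h𝔉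
  refine Set.Subset.antisymm (fun G hG => ?_) fun G hG => mem_LF.2 fun s hs =>
    ⟨mem_sigmaOfClass.2 ⟨G, hG, hs⟩, subset_form _ _ ⟨G, hG, hs, rfl⟩⟩
  rw [hLF]
  refine mem_LF.2 fun s hs => ?_
  obtain ⟨hs𝔉, hmem⟩ := mem_LF.1 hG s hs
  refine form_subset (hloc s hs𝔉) ?_ hmem
  rintro _ ⟨K, hK, hsK, rfl⟩
  rw [hLF] at hK
  exact mem_LF.1 hK s hsK

theorem isMultiplyLocal_sUnion (hσ : Setoid.IsPartition σ) (n : ℕ) {S : Set GroupClass.{u}}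
    (hS : ∀ 𝔉 ∈ S, IsMultiplyLocal σ n 𝔉) (hne : S.Nonempty) (hd : DirectedOn (· ⊆ ·) S) :
    IsMultiplyLocal σ n (⋃₀ S) := by
  induction n generalizing S with
  | zero => exact isFormation_sUnion hd hS
  | succ n ih =>
    have hdir : ∀ (s : σ) (T : Set GroupClass.{u}), DirectedOn (· ⊆ ·) T →
        DirectedOn (· ⊆ ·) ((fun 𝔉 => minimalSatellite σ n 𝔉 s) '' T) := by
      rintro s T hT _ ⟨𝔉₁, h₁, rfl⟩ _ ⟨𝔉₂, h₂, rfl⟩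
      obtain ⟨𝔉, h, le₁, le₂⟩ := hT 𝔉₁ h₁ 𝔉₂ h₂
      exact ⟨_, ⟨𝔉, h, rfl⟩, minimalSatellite_mono n le₁ s, minimalSatellite_mono n le₂ s⟩
    refine (isMultiplyLocal_succ_iff hσ).2
      ⟨isFormation_sUnion hd fun 𝔉 h => (hS 𝔉 h).isFormation,
        fun s => ⋃₀ ((fun 𝔉 => minimalSatellite σ n 𝔉 s) '' S), fun s => ?_, ?_, fun s hs => ?_⟩
    · refine isFormation_sUnion (hdir s S hd) ?_
      rintro _ ⟨𝔉, -, rfl⟩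
      exact isFormation_minimalSatellite hσ n 𝔉 s
    · ext G
      rw [mem_LF]
      constructor
      · rintro ⟨𝔉, h𝔉, hG⟩ s hs
        rw [← LF_minimalSatellite hσ (hS 𝔉 h𝔉)] at hG
        exact ⟨_, ⟨𝔉, h𝔉, rfl⟩, mem_LF.1 hG s hs⟩
      · intro hG
        have hex : ∀ s : sigmaOf σ G, ∃ 𝔉 : S, localQuotient s.1 G ∈ minimalSatellite σ n 𝔉 s.1 :=
          fun s => by
            obtain ⟨_, ⟨𝔉, h𝔉, rfl⟩, h⟩ := hG s s.2
            exact ⟨⟨𝔉, h𝔉⟩, h⟩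
        choose F hF using hex
        have : Finite (sigmaOf σ G) := finite_sigmaOf hσ G
        have : Nonempty S := hne.to_subtype
        obtain ⟨𝔉, h𝔉⟩ := hd.directed_val.finite_le F
        refine ⟨𝔉, 𝔉.2, ?_⟩
        rw [← LF_minimalSatellite hσ (hS 𝔉 𝔉.2)]
        exact mem_LF.2 fun s hs => minimalSatellite_mono n (h𝔉 ⟨s, hs⟩) s (hF ⟨s, hs⟩)
    · -- Members of `S` whose satellite is empty at `s` contribute nothing, and only the others are
      -- known to have an `n`-multiply local value there.
      obtain ⟨G, ⟨𝔉₀, h𝔉₀, hG⟩, hsG⟩ := mem_sigmaOfClass.1 hs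
      let T : Set GroupClass.{u} := {𝔉 ∈ S | s ∈ sigmaOfClass σ 𝔉}
      have hT : DirectedOn (· ⊆ ·) T := fun 𝔉₁ h₁ 𝔉₂ h₂ => by
        obtain ⟨𝔉, h, le₁, le₂⟩ := hd 𝔉₁ h₁.1 𝔉₂ h₂.1
        exact ⟨𝔉, ⟨h, sigmaOfClass_mono le₁ h₁.2⟩, le₁, le₂⟩
      have heq : ⋃₀ ((fun 𝔉 => minimalSatellite σ n 𝔉 s) '' S) =
          ⋃₀ ((fun 𝔉 => minimalSatellite σ n 𝔉 s) '' T) := by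
        refine Set.Subset.antisymm ?_
          (Set.sUnion_subset_sUnion (Set.image_mono fun _ h => h.1))
        rintro H ⟨_, ⟨𝔉, h𝔉, rfl⟩, hH⟩
        exact ⟨_, ⟨𝔉, ⟨h𝔉, hH.1⟩, rfl⟩, hH⟩
      change IsMultiplyLocal σ n (⋃₀ ((fun 𝔉 => minimalSatellite σ n 𝔉 s) '' S))
      rw [heq]
      refine ih ?_ ⟨_, 𝔉₀, ⟨h𝔉₀, mem_sigmaOfClass.2 ⟨G, hG, hsG⟩⟩, rfl⟩ (hdir s T hT)
      rintro _ ⟨𝔉, h𝔉, rfl⟩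
      exact isMultiplyLocal_minimalSatellite hσ n h𝔉.2

/-! ### The lattice of `τ`-closed `n`-multiply `σ`-local formations -/

theorem allGroups_mem_closedMultiplyLocal (τ : SubgroupFunctor.{u}) (n : ℕ) :
    allGroups ∈ closedMultiplyLocal τ σ n :=
  ⟨isMultiplyLocal_allGroups n, fun _ _ _ _ => trivial⟩

theorem isCompleteLattice_closedMultiplyLocal (hσ : Setoid.IsPartition σ)
    (τ : SubgroupFunctor.{u}) (n : ℕ) : IsCompleteLattice (closedMultiplyLocal τ σ n) where
  nonempty := ⟨allGroups, allGroups_mem_closedMultiplyLocal τ n⟩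
  isFormation _ h := h.1.isFormation
  sInter_mem _ hS _ := ⟨isMultiplyLocal_sInter hσ n fun _ h => (hS h).1,
    fun G hG H hH 𝔉 h => (hS h).2 G (hG 𝔉 h) H hH⟩
  exists_greatest := ⟨allGroups, allGroups_mem_closedMultiplyLocal τ n,
    fun 𝔉 _ => Set.subset_univ 𝔉⟩

theorem sUnion_mem_closedMultiplyLocal (hσ : Setoid.IsPartition σ) (τ : SubgroupFunctor.{u})
    (n : ℕ) {S : Set GroupClass.{u}} (hS : S ⊆ closedMultiplyLocal τ σ n) (hne : S.Nonempty)
    (hd : DirectedOn (· ⊆ ·) S) : ⋃₀ S ∈ closedMultiplyLocal τ σ n :=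
  ⟨isMultiplyLocal_sUnion hσ n (fun _ h => (hS h).1) hne hd,
    fun G ⟨𝔉, h𝔉, hG⟩ H hH => ⟨𝔉, h𝔉, (hS h𝔉).2 G hG H hH⟩⟩

end Sigma

end SigmaFormations

theorem theoremt11 (σ : Set (Set Nat.Primes)) (hσ : Setoid.IsPartition σ)
    (τ : SigmaFormations.SubgroupFunctor.{u}) (n : ℕ) :
    SigmaFormations.IsSeparable SigmaFormations.allGroups
      (SigmaFormations.closedMultiplyLocal τ σ n) :=
  SigmaFormations.isSeparable_of_directed
    (SigmaFormations.isCompleteLattice_closedMultiplyLocal hσ τ n)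
    (SigmaFormations.allGroups_mem_closedMultiplyLocal τ n)
    fun _ => SigmaFormations.sUnion_mem_closedMultiplyLocal hσ τ n
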